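/- Let $G$ be a finite simple graph with vertices $v_1,\dots,v_d$. The $d$-dimensional cube-connected graph $\mathrm{CC}(G,d)$ has vertex set $V(G)\times\{0,1\}^d$, where $(v_i,x)\sim(v_j,y)$ if and only if either $v_i\sim v_j$ in $G$ and $x=y$, or $i=j$ and $x,y$ differ in the $i$-th coordinate and in no other one. For $\vec s\in\{-1,1\}^d$ let $G[\vec s]$ be the graph obtained from $G$ by adding a loop of weight $s_i$ at $v_i$ for each $i$ (so its adjacency matrix is $A_G+\mathrm{diag}(s_1,\dots,s_d)$). For $1\le j\le d$ let $\vec s^{\,(j)}$ be the vector with $s_j=-1$ and $s_i=1$ for all $i\ne j$. Eigenvalues are counted with multiplicity. (1) If $G$ is connected, then the second largest adjacency eigenvalue of $\mathrm{CC}(G,d)$ is the largest eigenvalue of $G[\vec s^{\,(j)}]$ for some vertex $v_j$; more precisely, $$\lambda_2(\mathrm{CC}(G,d))=\max_{1\le j\le d}\lambda_1\big(G[\vec s^{\,(j)}]\big).$$ (2) Let $C_d$ be the cycle on $d$ vertices and let $\rho_2(d)$ be the algebraic connectivity (the second smallest Laplacian eigenvalue) of the $d$-dimensional cube-connected cycles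 $\mathrm{CC}(C_d,d)$. Then, as $d\to\infty$, $$\rho_2(d)=O\Big(2\big(1-\cos\tfrac{\pi}{d+2}\big)\Big),\qquad\text{and in fact}\qquad \rho_2(d)\le (1+o(1))\cdot 2\Big(1-\cos\tfrac{\pi}{d+2}\Big).$$ -/

import Mathlib

open Filter Asymptotics

section CubeConnected

variable {V : Type*}

/-- The cube-connected graph `CC(G, d)` of a graph `G` on `d` vertices. The coordinates of the
`d`-dimensional cube are indexed by the vertices of `G`, so the vertex set is `V × {0,1}^V`.
Adjacent are `(u, x)` and `(v, x)` when `u` and `v` are adjacent in `G`, and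
`(v, x)` and `(v, y)` when `x` and `y` differ in coordinate `v` and in no other coordinate. -/
def cubeConnected (G : SimpleGraph V) : SimpleGraph (V × (V → Bool)) where
  Adj p q := (G.Adj p.1 q.1 ∧ p.2 = q.2) ∨
    (p.1 = q.1 ∧ ∀ k, p.2 k ≠ q.2 k ↔ k = p.1)
  symm := by
    constructor
    rintro ⟨u, x⟩ ⟨v, y⟩ (⟨h, e⟩ | ⟨e, h⟩)
    · exact Or.inl ⟨h.symm, e.symm⟩
    · refine Or.inr ⟨e.symm, fun k => ?_⟩
      rw [ne_comm, h k]
      exact iff_of_eq (congrArg _ e)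
  loopless := by
    constructor
    rintro ⟨u, x⟩ (⟨h, -⟩ | ⟨-, h⟩)
    · exact G.loopless.irrefl _ h
    · exact ((h u).2 rfl) rfl

instance [Fintype V] [DecidableEq V] (G : SimpleGraph V) [DecidableRel G.Adj] :
    DecidableRel (cubeConnected G).Adj := fun p q =>
  inferInstanceAs (Decidable ((G.Adj p.1 q.1 ∧ p.2 = q.2) ∨
    (p.1 = q.1 ∧ ∀ k, p.2 k ≠ q.2 k ↔ k = p.1)))

/-- The `d`-dimensional cube-connected cycles. -/
abbrev cubeConnectedCycles (d : ℕ) : SimpleGraph (Fin d × (Fin d → Bool)) :=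
  cubeConnected (SimpleGraph.cycleGraph d)

/-- The weighted adjacency matrix of `G[s]`, the graph `G` with a loop of weight `s v` added
at each vertex `v`. -/
def loopedAdjMatrix [DecidableEq V] (G : SimpleGraph V) [DecidableRel G.Adj] (s : V → ℝ) :
    Matrix V V ℝ :=
  G.adjMatrix ℝ + Matrix.diagonal s

/-- The loop weights with `-1` at `j` and `+1` at every other vertex. -/
def oneNeg [DecidableEq V] (j : V) : V → ℝ := fun i => if i = j then -1 else 1

theorem isHermitian_adjMatrix (G : SimpleGraph V) [DecidableRel G.Adj] :
    (G.adjMatrix ℝ).IsHermitian := by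
  rw [Matrix.IsHermitian, Matrix.conjTranspose_eq_transpose_of_trivial]
  exact G.isSymm_adjMatrix

theorem isHermitian_loopedAdjMatrix [DecidableEq V] (G : SimpleGraph V) [DecidableRel G.Adj]
    (s : V → ℝ) : (loopedAdjMatrix G s).IsHermitian :=
  (isHermitian_adjMatrix G).add (Matrix.isHermitian_diagonal s)

theorem isHermitian_lapMatrix [Fintype V] [DecidableEq V] (G : SimpleGraph V)
    [DecidableRel G.Adj] : (G.lapMatrix ℝ).IsHermitian := by
  rw [Matrix.IsHermitian, Matrix.conjTranspose_eq_transpose_of_trivial]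
  exact G.isSymm_lapMatrix (R := ℝ)

/-- The `k`-th entry, counted from `k = 0`, in the list of the eigenvalues of a real symmetric
matrix in decreasing order and with multiplicity (`0` if there are at most `k` of them). -/
noncomputable def eigenvalueDesc [Fintype V] [DecidableEq V] {A : Matrix V V ℝ}
    (hA : A.IsHermitian) (k : ℕ) : ℝ :=
  if h : k < Fintype.card V then hA.eigenvalues₀ ⟨k, h⟩ else 0

/-- The `k`-th entry, counted from `k = 0`, in the list of the eigenvalues of a real symmetric
matrix in increasing order and with multiplicity (`0` if there are at most `k` of them). -/
noncomputable def eigenvalueAsc [Fintype V] [DecidableEq V] {A : Matrix V V ℝ}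
    (hA : A.IsHermitian) (k : ℕ) : ℝ :=
  if h : k < Fintype.card V then hA.eigenvalues₀ (Fin.rev ⟨k, h⟩) else 0

/-- The second largest adjacency eigenvalue `λ₂(G)`. -/
noncomputable def secondLargestAdjEigenvalue [Fintype V] [DecidableEq V] (G : SimpleGraph V)
    [DecidableRel G.Adj] : ℝ :=
  eigenvalueDesc (isHermitian_adjMatrix G) 1

/-- The largest adjacency eigenvalue of the graph `G[s]` with weighted loops. -/
noncomputable def largestLoopedEigenvalue [Fintype V] [DecidableEq V] (G : SimpleGraph V)
    [DecidableRel G.Adj] (s : V → ℝ) : ℝ :=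
  eigenvalueDesc (isHermitian_loopedAdjMatrix G s) 0

/-- The algebraic connectivity `ρ₂(G)`: the second smallest eigenvalue of the Laplacian. -/
noncomputable def algebraicConnectivity [Fintype V] [DecidableEq V] (G : SimpleGraph V)
    [DecidableRel G.Adj] : ℝ :=
  eigenvalueAsc (isHermitian_lapMatrix G) 1

end CubeConnected

/-! Flipping coordinate `v` multiplies the cube character `χ_S` by `-1` if `v ∈ S` and by `1`
otherwise. Hence on functions `f ⊗ χ_S` the adjacency operator of `CC(G, d)` acts as that of `G`
with loop weights `signVector S`, and these blocks make up the whole spectrum. Larger loop weights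
give a larger `λ₁`, so among nonempty `S` the singletons win. The block `S = ∅` tops them, which
gives `λ₂ ≥ λ₁(G[s⁽ʲ⁾])`. For the converse, `λ₂` of the block `∅` is dominated too: some combination
of its two leading eigenvectors vanishes at `j`, and such a vector does not see the loop at `j`
(`exists_secondLargestAdjEigenvalue_le`). For cycles, the block `{0}` of the Laplacian adds a
penalty at vertex `0` only. The function `sin(πi/d)` vanishes there and has Rayleigh quotient `2(1 -
cos(π/d))`, which is asymptotic to the stated bound. -/

/-! ### Rayleigh quotients and the two extreme eigenvalues at either end -/

section SpectralBounds

open Matrix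

variable {n : Type*} [Fintype n] {A : Matrix n n ℝ}

theorem dotProduct_mulVec_comm_of_isHermitian (hA : A.IsHermitian) (u v : n → ℝ) :
    u ⬝ᵥ A *ᵥ v = v ⬝ᵥ A *ᵥ u := by
  have hT : Aᵀ = A := by
    rw [← conjTranspose_eq_transpose_of_trivial]; exact hA
  rw [dotProduct_mulVec, ← mulVec_transpose, hT, dotProduct_comm]

/-- Serves to find, in the span of two vectors, a nonzero vector killed by a given linear
functional. -/
theorem exists_ne_zero_combination (α β : ℝ) :
    ∃ a b : ℝ, (a ≠ 0 ∨ b ≠ 0) ∧ a * α + b * β = 0 := by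
  by_cases h : α = 0
  · exact ⟨1, 0, by simp, by simp [h]⟩
  · exact ⟨-β, α, Or.inr h, by ring⟩

theorem dotProduct_self_combination {p q : n → ℝ} (hpq : p ⬝ᵥ q = 0) (a b : ℝ) :
    (a • p + b • q) ⬝ᵥ (a • p + b • q) = a ^ 2 * (p ⬝ᵥ p) + b ^ 2 * (q ⬝ᵥ q) := by
  have hqp : q ⬝ᵥ p = 0 := by rw [dotProduct_comm, hpq]
  simp only [add_dotProduct, dotProduct_add, smul_dotProduct, dotProduct_smul, smul_eq_mul,
    hpq, hqp]
  ring

theorem quadraticForm_combination (hA : A.IsHermitian) {p q : n → ℝ}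
    (hpq : p ⬝ᵥ A *ᵥ q = 0) (a b : ℝ) :
    (a • p + b • q) ⬝ᵥ A *ᵥ (a • p + b • q) =
      a ^ 2 * (p ⬝ᵥ A *ᵥ p) + b ^ 2 * (q ⬝ᵥ A *ᵥ q) := by
  have hqp : q ⬝ᵥ A *ᵥ p = 0 := by rw [dotProduct_mulVec_comm_of_isHermitian hA, hpq]
  simp only [mulVec_add, mulVec_smul, add_dotProduct, dotProduct_add, smul_dotProduct,
    dotProduct_smul, smul_eq_mul, hpq, hqp]
  ring

theorem combination_pos {p q : ℝ} (hp : 0 < p) (hq : 0 < q) {a b : ℝ} (h : a ≠ 0 ∨ b ≠ 0) :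
    0 < a ^ 2 * p + b ^ 2 * q := by
  rcases h with h | h
  · have := pow_pos (abs_pos.2 h) 2
    rw [sq_abs] at this
    positivity
  · have := pow_pos (abs_pos.2 h) 2
    rw [sq_abs] at this
    positivity

variable [DecidableEq n]

/-- An orthonormal family of eigenvectors for the sorted eigenvalues, together with the
diagonalization of the two quadratic forms. -/
theorem exists_sorted_eigenvectors (hA : A.IsHermitian) :
    ∃ b : Fin (Fintype.card n) → n → ℝ,
      (∀ i, b i ⬝ᵥ b i = 1) ∧ (∀ i j, i ≠ j → b i ⬝ᵥ b j = 0) ∧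
      (∀ i, A *ᵥ b i = hA.eigenvalues₀ i • b i) ∧
      (∀ w, w ⬝ᵥ w = ∑ i, (b i ⬝ᵥ w) ^ 2) ∧
      (∀ w, w ⬝ᵥ A *ᵥ w = ∑ i, hA.eigenvalues₀ i * (b i ⬝ᵥ w) ^ 2) := by
  -- This is the equivalence through which `eigenvalues` is defined from `eigenvalues₀`, so
  -- reindexing by it restores the sorted order.
  set e : Fin (Fintype.card n) ≃ n := Fintype.equivOfCardEq (Fintype.card_fin _) with he
  let B := hA.eigenvectorBasis.reindex e.symm
  have hin : ∀ x y : EuclideanSpace ℝ n, inner ℝ x y = (x : n → ℝ) ⬝ᵥ (y : n → ℝ) := fun x y => by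
    simp [PiLp.inner_apply, dotProduct, mul_comm]
  have horth := orthonormal_iff_ite.1 B.orthonormal
  have heig : ∀ i, A *ᵥ (B i : n → ℝ) = hA.eigenvalues₀ i • (B i : n → ℝ) := fun i => by
    have := hA.mulVec_eigenvectorBasis (e i)
    rw [IsHermitian.eigenvalues, ← he, e.symm_apply_apply] at this
    simpa [B] using! this
  have hsum : ∀ x y : n → ℝ,
      x ⬝ᵥ y = ∑ i, ((B i : n → ℝ) ⬝ᵥ x) * ((B i : n → ℝ) ⬝ᵥ y) := fun x y => by
    have := B.sum_inner_mul_inner (WithLp.toLp 2 x) (WithLp.toLp 2 y)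
    simp only [hin] at this
    rw [← this]
    exact Finset.sum_congr rfl fun i _ => by rw [dotProduct_comm x]
  refine ⟨fun i => B i, fun i => ?_, fun i j hij => ?_, heig, fun w => ?_, fun w => ?_⟩
  · rw [← hin, horth, if_pos rfl]
  · rw [← hin, horth, if_neg hij]
  · rw [hsum]
    exact Finset.sum_congr rfl fun i _ => by ring
  · rw [hsum]
    refine Finset.sum_congr rfl fun i _ => ?_
    rw [dotProduct_mulVec_comm_of_isHermitian hA, heig, dotProduct_smul, smul_eq_mul,
      dotProduct_comm w]
    ring

/-- A top eigenvector, and the Rayleigh bound it provides. -/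
theorem exists_eigenvector_eigenvalueDesc_zero [Nonempty n] (hA : A.IsHermitian) :
    ∃ u : n → ℝ, u ⬝ᵥ u = 1 ∧ A *ᵥ u = eigenvalueDesc hA 0 • u ∧
      ∀ w, w ⬝ᵥ A *ᵥ w ≤ eigenvalueDesc hA 0 * (w ⬝ᵥ w) := by
  obtain ⟨b, h1, -, he, hw, hq⟩ := exists_sorted_eigenvectors hA
  have hc : 0 < Fintype.card n := Fintype.card_pos
  simp only [eigenvalueDesc, dif_pos hc]
  refine ⟨b ⟨0, hc⟩, h1 _, he _, fun w => ?_⟩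
  rw [hq, hw, Finset.mul_sum]
  gcongr with i
  exact hA.eigenvalues₀_antitone (Nat.zero_le i.1)

/-- Eigenvectors for the two largest eigenvalues, and the Rayleigh bound they provide. -/
theorem exists_eigenvectors_eigenvalueDesc_one [Nontrivial n] (hA : A.IsHermitian) :
    ∃ u v : n → ℝ, u ⬝ᵥ u = 1 ∧ v ⬝ᵥ v = 1 ∧ u ⬝ᵥ v = 0 ∧
      (A *ᵥ u = eigenvalueDesc hA 0 • u) ∧ (A *ᵥ v = eigenvalueDesc hA 1 • v) ∧
      eigenvalueDesc hA 1 ≤ eigenvalueDesc hA 0 ∧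
      ∀ w, u ⬝ᵥ w = 0 → w ⬝ᵥ A *ᵥ w ≤ eigenvalueDesc hA 1 * (w ⬝ᵥ w) := by
  obtain ⟨b, h1, h0, he, hw, hq⟩ := exists_sorted_eigenvectors hA
  have hc : 1 < Fintype.card n := Fintype.one_lt_card
  have hc0 : 0 < Fintype.card n := Fintype.card_pos
  simp only [eigenvalueDesc, dif_pos hc, dif_pos hc0]
  refine ⟨b ⟨0, hc0⟩, b ⟨1, hc⟩, h1 _, h1 _, h0 _ _ (by simp), he _, he _,
    hA.eigenvalues₀_antitone (Nat.zero_le 1), fun w h => ?_⟩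
  rw [hq, hw, Finset.mul_sum]
  refine Finset.sum_le_sum fun i _ => ?_
  rcases Nat.eq_zero_or_pos i.1 with hi | hi
  · have : i = ⟨0, hc0⟩ := Fin.ext hi
    rw [this, h]; simp
  · exact mul_le_mul_of_nonneg_right (hA.eigenvalues₀_antitone (show 1 ≤ i.1 from hi))
      (sq_nonneg _)

theorem exists_rayleigh_bound_eigenvalueAsc_one [Nontrivial n] (hA : A.IsHermitian) :
    ∃ u : n → ℝ, ∀ w, u ⬝ᵥ w = 0 → eigenvalueAsc hA 1 * (w ⬝ᵥ w) ≤ w ⬝ᵥ A *ᵥ w := by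
  obtain ⟨b, -, -, -, hw, hq⟩ := exists_sorted_eigenvectors hA
  have hc : 1 < Fintype.card n := Fintype.one_lt_card
  have hc0 : 0 < Fintype.card n := Fintype.card_pos
  simp only [eigenvalueAsc, dif_pos hc]
  -- `eigenvalues₀` decreases, so the smallest eigenvalue sits at the last index.
  refine ⟨b (Fin.rev ⟨0, hc0⟩), fun w h => ?_⟩
  rw [hq, hw, Finset.mul_sum]
  refine Finset.sum_le_sum fun i _ => ?_
  by_cases hi : i = Fin.rev ⟨0, hc0⟩
  · rw [hi, h]; simp
  · refine mul_le_mul_of_nonneg_right (hA.eigenvalues₀_antitone ?_) (sq_nonneg _)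
    rw [Fin.le_def, Fin.val_rev]
    have : i.1 ≠ _ := fun h => hi (Fin.ext h)
    rw [Fin.val_rev] at this
    have := i.2
    simp only at *
    omega

/-- Courant–Fischer on the plane spanned by `p` and `q`: it meets the orthogonal complement of the
top eigenvector. Orthogonality for both forms removes the cross terms. -/
theorem le_eigenvalueDesc_one [Nontrivial n] (hA : A.IsHermitian) {p q : n → ℝ} {μ : ℝ}
    (hp : 0 < p ⬝ᵥ p) (hq : 0 < q ⬝ᵥ q) (hpq : p ⬝ᵥ q = 0) (hpAq : p ⬝ᵥ A *ᵥ q = 0)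
    (hpA : μ * (p ⬝ᵥ p) ≤ p ⬝ᵥ A *ᵥ p) (hqA : μ * (q ⬝ᵥ q) ≤ q ⬝ᵥ A *ᵥ q) :
    μ ≤ eigenvalueDesc hA 1 := by
  obtain ⟨u, -, -, -, -, -, -, -, hu⟩ := exists_eigenvectors_eigenvalueDesc_one hA
  obtain ⟨a, b, hab, h0⟩ := exists_ne_zero_combination (u ⬝ᵥ p) (u ⬝ᵥ q)
  have h := hu (a • p + b • q) (by simpa [dotProduct_add, dotProduct_smul] using h0)
  rw [dotProduct_self_combination hpq, quadraticForm_combination hA hpAq] at h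
  have hpos := combination_pos hp hq hab
  refine le_of_mul_le_mul_right (le_trans ?_ h) hpos
  nlinarith [mul_le_mul_of_nonneg_left hpA (sq_nonneg a),
    mul_le_mul_of_nonneg_left hqA (sq_nonneg b)]

theorem eigenvalueAsc_one_le [Nontrivial n] (hA : A.IsHermitian) {p q : n → ℝ} {μ : ℝ}
    (hp : 0 < p ⬝ᵥ p) (hq : 0 < q ⬝ᵥ q) (hpq : p ⬝ᵥ q = 0) (hpAq : p ⬝ᵥ A *ᵥ q = 0)
    (hpA : p ⬝ᵥ A *ᵥ p ≤ μ * (p ⬝ᵥ p)) (hqA : q ⬝ᵥ A *ᵥ q ≤ μ * (q ⬝ᵥ q)) :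
    eigenvalueAsc hA 1 ≤ μ := by
  obtain ⟨u, hu⟩ := exists_rayleigh_bound_eigenvalueAsc_one hA
  obtain ⟨a, b, hab, h0⟩ := exists_ne_zero_combination (u ⬝ᵥ p) (u ⬝ᵥ q)
  have h := hu (a • p + b • q) (by simpa [dotProduct_add, dotProduct_smul] using h0)
  rw [dotProduct_self_combination hpq, quadraticForm_combination hA hpAq] at h
  have hpos := combination_pos hp hq hab
  refine le_of_mul_le_mul_right (le_trans h ?_) hpos
  nlinarith [mul_le_mul_of_nonneg_left hpA (sq_nonneg a),
    mul_le_mul_of_nonneg_left hqA (sq_nonneg b)]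

theorem eigenvalueAsc_nonneg (hA : A.PosSemidef) (k : ℕ) :
    0 ≤ eigenvalueAsc hA.isHermitian k := by
  unfold eigenvalueAsc
  split_ifs with h
  · obtain ⟨b, h1, -, he, -, -⟩ := exists_sorted_eigenvectors hA.isHermitian
    have := hA.dotProduct_mulVec_nonneg (b (Fin.rev ⟨k, h⟩))
    rw [he, dotProduct_smul, star_trivial, h1] at this
    simpa using this
  · exact le_rfl

end SpectralBounds

/-! ### Characters of the cube and the block decomposition of the adjacency operator -/

section CubeCharacters

open Matrix

variable {V : Type*}

/-- The sign `(-1)^b` of a bit. -/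
def bitSign (b : Bool) : ℝ := if b then -1 else 1

theorem bitSign_not (b : Bool) : bitSign (!b) = -bitSign b := by cases b <;> simp [bitSign]

theorem bitSign_mul_self (b : Bool) : bitSign b * bitSign b = 1 := by cases b <;> simp [bitSign]

theorem one_add_bitSign_mul (b c : Bool) :
    1 + bitSign b * bitSign c = if b = c then 2 else 0 := by
  cases b <;> cases c <;> norm_num [bitSign]

/-- The character of the cube attached to a set `S` of coordinates. -/
def cubeCharacter (S : Finset V) (x : V → Bool) : ℝ := ∏ k ∈ S, bitSign (x k)

theorem cubeCharacter_mul_self (S : Finset V) (x : V → Bool) :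
    cubeCharacter S x * cubeCharacter S x = 1 := by
  simp [cubeCharacter, ← Finset.prod_mul_distrib, bitSign_mul_self]

/-- The function `(v, x) ↦ f v * χ_S x` on the vertices of the cube-connected graph. -/
def cubeWave (f : V → ℝ) (S : Finset V) : V × (V → Bool) → ℝ :=
  fun p => f p.1 * cubeCharacter S p.2

theorem cubeWave_smul (c : ℝ) (f : V → ℝ) (S : Finset V) :
    cubeWave (c • f) S = c • cubeWave f S := by
  funext p; simp [cubeWave, mul_assoc]

variable [DecidableEq V]

/-- The point of the cube obtained by flipping coordinate `v`. -/
def cubeFlip (v : V) (x : V → Bool) : V → Bool := Function.update x v (!x v)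

theorem cubeFlip_involutive (v : V) : Function.Involutive (cubeFlip v) := fun x => by
  simp [cubeFlip]

theorem forall_ne_iff_eq_cubeFlip (v : V) (x y : V → Bool) :
    (∀ k, x k ≠ y k ↔ k = v) ↔ y = cubeFlip v x := by
  constructor
  · intro h
    funext k
    by_cases hk : k = v
    · subst hk
      have := (h k).2 rfl
      simp only [cubeFlip, Function.update_self]
      exact (Bool.eq_not_of_ne this.symm)
    · have := mt (h k).1 hk
      simp only [cubeFlip, Function.update_of_ne hk]
      exact (not_not.1 this).symm
  · rintro rfl k
    by_cases hk : k = v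
    · subst hk; simp [cubeFlip]
    · simp [cubeFlip, hk]

/-- The loop weights with `-1` on `S` and `+1` elsewhere. -/
def signVector (S : Finset V) : V → ℝ := fun v => if v ∈ S then -1 else 1

theorem signVector_singleton (j : V) : signVector {j} = oneNeg j := by
  funext i; simp [signVector, oneNeg]

theorem cubeCharacter_cubeFlip (S : Finset V) (v : V) (x : V → Bool) :
    cubeCharacter S (cubeFlip v x) = signVector S v * cubeCharacter S x := by
  unfold cubeCharacter signVector cubeFlip
  split_ifs with h
  · rw [← Finset.mul_prod_erase S _ h, ← Finset.mul_prod_erase S (fun k => bitSign (x k)) h,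
      Function.update_self, bitSign_not, neg_mul, neg_one_mul]
    congr 2
    refine Finset.prod_congr rfl fun k hk => ?_
    rw [Function.update_of_ne (Finset.ne_of_mem_erase hk)]
  · rw [one_mul]
    refine Finset.prod_congr rfl fun k hk => ?_
    rw [Function.update_of_ne (ne_of_mem_of_not_mem hk h)]

variable [Fintype V]

theorem sum_comp_cubeFlip (v : V) (h : (V → Bool) → ℝ) : ∑ x, h (cubeFlip v x) = ∑ x, h x :=
  Equiv.sum_comp (cubeFlip_involutive v).toPerm h

theorem sum_cubeCharacter_eq_zero {S : Finset V} {v : V} (hv : v ∈ S) :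
    ∑ x, cubeCharacter S x = 0 := by
  have := sum_comp_cubeFlip v (cubeCharacter S)
  simp only [cubeCharacter_cubeFlip, ← Finset.mul_sum, signVector, if_pos hv] at this
  linarith

/-- Fourier inversion on the cube. -/
theorem cube_fourier_inversion (h : (V → Bool) → ℝ) (y : V → Bool) :
    ∑ S : Finset V, (∑ x, h x * cubeCharacter S x) * cubeCharacter S y =
      2 ^ Fintype.card V * h y := by
  have key : ∀ x, ∑ S : Finset V, cubeCharacter S x * cubeCharacter S y =
      if x = y then 2 ^ Fintype.card V else 0 := fun x => by
    -- The sum over `S` is the expansion of `∏ k, (1 + (-1)^(x k + y k))`, which has a zero factor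
    -- wherever `x` and `y` differ.
    have h1 := Finset.prod_one_add (f := fun k => bitSign (x k) * bitSign (y k)) Finset.univ
    rw [Finset.powerset_univ] at h1
    simp only [cubeCharacter, ← Finset.prod_mul_distrib]
    rw [← h1]
    simp only [one_add_bitSign_mul]
    split_ifs with hxy
    · subst hxy; simp
    · obtain ⟨k, hk⟩ := Function.ne_iff.1 hxy
      exact Finset.prod_eq_zero (Finset.mem_univ k) (if_neg hk)
  calc _ = ∑ S : Finset V, ∑ x, h x * (cubeCharacter S x * cubeCharacter S y) := by
        simp only [Finset.sum_mul, mul_assoc]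
    _ = ∑ x, h x * ∑ S : Finset V, cubeCharacter S x * cubeCharacter S y := by
        rw [Finset.sum_comm]; simp only [Finset.mul_sum]
    _ = _ := by simp only [key]; simp [mul_comm]

theorem cube_eq_of_fourier_eq_zero (h : (V → Bool) → ℝ)
    (hS : ∀ S : Finset V, S.Nonempty → ∑ x, h x * cubeCharacter S x = 0) (y z : V → Bool) :
    h y = h z := by
  have key : ∀ y, 2 ^ Fintype.card V * h y = ∑ x, h x := fun y => by
    rw [← cube_fourier_inversion, Finset.sum_eq_single ∅]
    · simp [cubeCharacter]
    · intro S _ hne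
      rw [hS S (Finset.nonempty_iff_ne_empty.2 hne), zero_mul]
    · simp
  have := (key y).trans (key z).symm
  exact mul_left_cancel₀ (by positivity) this

variable (G : SimpleGraph V) [DecidableRel G.Adj]

theorem adjMatrix_cubeConnected_mulVec (g : V × (V → Bool) → ℝ) (v : V) (x : V → Bool) :
    ((cubeConnected G).adjMatrix ℝ *ᵥ g) (v, x) =
      (G.adjMatrix ℝ *ᵥ fun u => g (u, x)) v + g (v, cubeFlip v x) := by
  have hadj : ∀ u y, (cubeConnected G).adjMatrix ℝ (v, x) (u, y) =
      (if y = x then G.adjMatrix ℝ v u else 0) +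
        (if u = v then if y = cubeFlip v x then 1 else 0 else 0) := fun u y => by
    rw [SimpleGraph.adjMatrix_apply]
    have : (cubeConnected G).Adj (v, x) (u, y) ↔
        (G.Adj v u ∧ x = y) ∨ (v = u ∧ y = cubeFlip v x) := by
      rw [← forall_ne_iff_eq_cubeFlip]; rfl
    simp only [this, SimpleGraph.adjMatrix_apply]
    by_cases huv : u = v
    · subst huv; simp
    · simp only [huv, Ne.symm huv, false_and, or_false, if_false, add_zero]
      by_cases hxy : y = x
      · subst hxy; simp
      · simp [hxy, Ne.symm hxy]
  simp only [mulVec, dotProduct, Fintype.sum_prod_type, hadj, add_mul, Finset.sum_add_distrib]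
  simp

theorem loopedAdjMatrix_mulVec_apply (s f : V → ℝ) (v : V) :
    (loopedAdjMatrix G s *ᵥ f) v = (G.adjMatrix ℝ *ᵥ f) v + s v * f v := by
  rw [loopedAdjMatrix, add_mulVec, Pi.add_apply, mulVec_diagonal]

theorem adjMatrix_cubeConnected_mulVec_cubeWave (f : V → ℝ) (S : Finset V) :
    (cubeConnected G).adjMatrix ℝ *ᵥ cubeWave f S =
      cubeWave (loopedAdjMatrix G (signVector S) *ᵥ f) S := by
  funext ⟨v, x⟩
  rw [adjMatrix_cubeConnected_mulVec]
  simp only [cubeWave, loopedAdjMatrix_mulVec_apply, cubeCharacter_cubeFlip]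
  have : (fun u => f u * cubeCharacter S x) = cubeCharacter S x • f := by
    funext u; simp [mul_comm]
  rw [this, mulVec_smul, Pi.smul_apply, smul_eq_mul]
  ring

theorem cubeWave_dotProduct_self_character (f h : V → ℝ) (S : Finset V) :
    cubeWave f S ⬝ᵥ cubeWave h S = 2 ^ Fintype.card V * (f ⬝ᵥ h) := by
  simp only [dotProduct, cubeWave, Fintype.sum_prod_type, Finset.mul_sum]
  refine Finset.sum_congr rfl fun v _ => ?_
  simp [mul_mul_mul_comm, cubeCharacter_mul_self]

theorem cubeWave_dotProduct_singleton (f h : V → ℝ) (j : V) :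
    cubeWave f ∅ ⬝ᵥ cubeWave h {j} = 0 := by
  simp only [dotProduct, cubeWave, Fintype.sum_prod_type]
  refine Finset.sum_eq_zero fun v _ => ?_
  have := sum_cubeCharacter_eq_zero (Finset.mem_singleton_self j)
  simp only [cubeCharacter, Finset.prod_empty, mul_one, ← mul_assoc]
  rw [← Finset.mul_sum]
  exact mul_eq_zero_of_right _ this

/-- The component of a function on the cube-connected graph along a character. -/
def cubeCoeff (g : V × (V → Bool) → ℝ) (S : Finset V) : V → ℝ :=
  fun v => ∑ x, g (v, x) * cubeCharacter S x

/-- Since flips are involutions, projection onto a character intertwines the two operators. Thus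
every eigenvector of `CC(G, d)` projects to an eigenvector of each block, or to zero. -/
theorem cubeCoeff_adjMatrix_mulVec (g : V × (V → Bool) → ℝ) (S : Finset V) :
    cubeCoeff ((cubeConnected G).adjMatrix ℝ *ᵥ g) S =
      loopedAdjMatrix G (signVector S) *ᵥ cubeCoeff g S := by
  funext v
  rw [loopedAdjMatrix_mulVec_apply]
  simp only [cubeCoeff, adjMatrix_cubeConnected_mulVec, add_mul, Finset.sum_add_distrib]
  congr 1
  · simp only [mulVec, dotProduct, Finset.sum_mul, cubeCoeff, Finset.mul_sum]
    rw [Finset.sum_comm]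
    simp only [mul_assoc]
  · rw [← sum_comp_cubeFlip v, Finset.mul_sum]
    refine Finset.sum_congr rfl fun x _ => ?_
    rw [cubeFlip_involutive v x, cubeCharacter_cubeFlip]
    ring

end CubeCharacters

/-! ### The second largest adjacency eigenvalue -/

section SecondEigenvalue

open Matrix

theorem dotProduct_self_pos_of_ne_zero {n : Type*} [Fintype n] {w : n → ℝ} (hw : w ≠ 0) :
    0 < w ⬝ᵥ w :=
  lt_of_le_of_ne (Finset.sum_nonneg fun _ _ => mul_self_nonneg _)
    (Ne.symm (mt dotProduct_self_eq_zero.1 hw))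

theorem signVector_anti {V : Type*} [DecidableEq V] {S T : Finset V} (h : S ⊆ T) : signVector T ≤ signVector S := fun v => by
  unfold signVector
  split_ifs with h1 h2 h2
  · exact le_rfl
  · norm_num
  · exact absurd (h h2) h1
  · exact le_rfl

variable {V : Type*} [Fintype V] [DecidableEq V] (G : SimpleGraph V) [DecidableRel G.Adj]

theorem loopedAdjMatrix_quadraticForm (s f : V → ℝ) :
    f ⬝ᵥ loopedAdjMatrix G s *ᵥ f = f ⬝ᵥ G.adjMatrix ℝ *ᵥ f + ∑ v, s v * f v ^ 2 := by
  simp only [dotProduct, loopedAdjMatrix_mulVec_apply, mul_add, Finset.sum_add_distrib]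
  congr 1
  exact Finset.sum_congr rfl fun v _ => by ring

theorem loopedAdjMatrix_quadraticForm_mono {s t : V → ℝ} (h : s ≤ t) (f : V → ℝ) :
    f ⬝ᵥ loopedAdjMatrix G s *ᵥ f ≤ f ⬝ᵥ loopedAdjMatrix G t *ᵥ f := by
  simp only [loopedAdjMatrix_quadraticForm]
  gcongr with v
  exact h v

instance [Nonempty V] : Nontrivial (V × (V → Bool)) := by
  obtain ⟨v⟩ := ‹Nonempty V›
  exact ⟨(v, fun _ => true), (v, fun _ => false), fun h => by
    simpa using congrFun (congrArg Prod.snd h) v⟩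

theorem largestLoopedEigenvalue_le_secondLargestAdjEigenvalue (j : V) :
    largestLoopedEigenvalue G (oneNeg j) ≤ secondLargestAdjEigenvalue (cubeConnected G) := by
  have : Nonempty V := ⟨j⟩
  obtain ⟨f, hf, hfA, -⟩ :=
    exists_eigenvector_eigenvalueDesc_zero (isHermitian_loopedAdjMatrix G (signVector ∅))
  obtain ⟨h, hh, hhA, -⟩ :=
    exists_eigenvector_eigenvalueDesc_zero (isHermitian_loopedAdjMatrix G (oneNeg j))
  obtain ⟨-, -, -, hle⟩ :=
    exists_eigenvector_eigenvalueDesc_zero (isHermitian_loopedAdjMatrix G (signVector ∅))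
  have hmono := (loopedAdjMatrix_quadraticForm_mono G
    (signVector_anti (Finset.empty_subset {j})) h).trans (hle h)
  rw [signVector_singleton, hhA, dotProduct_smul, hh, smul_eq_mul, mul_one, mul_one] at hmono
  unfold secondLargestAdjEigenvalue
  refine le_eigenvalueDesc_one _ (p := cubeWave f ∅) (q := cubeWave h {j}) ?_ ?_
    (cubeWave_dotProduct_singleton _ _ _) ?_ ?_ ?_
  · rw [cubeWave_dotProduct_self_character, hf]; simp
  · rw [cubeWave_dotProduct_self_character, hh]; simp
  · rw [adjMatrix_cubeConnected_mulVec_cubeWave, cubeWave_dotProduct_singleton]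
  · rw [adjMatrix_cubeConnected_mulVec_cubeWave, hfA, cubeWave_smul, dotProduct_smul, smul_eq_mul,
      cubeWave_dotProduct_self_character, hf]
    unfold largestLoopedEigenvalue
    gcongr
  · rw [adjMatrix_cubeConnected_mulVec_cubeWave, signVector_singleton, hhA, cubeWave_smul,
      dotProduct_smul, smul_eq_mul]
    exact le_rfl

/-- If `μ` exceeds every `λ₁(G[s⁽ʲ⁾])`, then a `μ`-eigenvector of the cube-connected graph does
not depend on the cube coordinate. -/
theorem exists_eq_cubeWave_empty {μ : ℝ} (hμ : ∀ j, largestLoopedEigenvalue G (oneNeg j) < μ)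
    {g : V × (V → Bool) → ℝ} (hg : (cubeConnected G).adjMatrix ℝ *ᵥ g = μ • g) :
    ∃ f, g = cubeWave f ∅ := by
  have hcoeff : ∀ S : Finset V, S.Nonempty → cubeCoeff g S = 0 := by
    rintro S ⟨j, hj⟩
    have : Nonempty V := ⟨j⟩
    by_contra hne
    have hA := cubeCoeff_adjMatrix_mulVec G g S
    have hs : cubeCoeff (μ • g) S = μ • cubeCoeff g S := by
      funext v; simp [cubeCoeff, Finset.mul_sum, mul_assoc]
    rw [hg, hs] at hA
    obtain ⟨-, -, -, hle⟩ :=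
      exists_eigenvector_eigenvalueDesc_zero (isHermitian_loopedAdjMatrix G (oneNeg j))
    -- A nonzero component along `S ∋ j` would have Rayleigh quotient `μ` in the block `S`, hence at
    -- least `μ` in the block `{j}`.
    have h1 := loopedAdjMatrix_quadraticForm_mono G
      (signVector_anti (Finset.singleton_subset_iff.2 hj)) (cubeCoeff g S)
    rw [← hA, dotProduct_smul, smul_eq_mul, signVector_singleton] at h1
    have h2 := le_of_mul_le_mul_right (h1.trans (hle _)) (dotProduct_self_pos_of_ne_zero hne)
    exact absurd (hμ j) (not_lt.2 h2)
  refine ⟨fun v => g (v, fun _ => true), ?_⟩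
  funext ⟨v, x⟩
  have := cube_eq_of_fourier_eq_zero (fun x => g (v, x)) (fun S hS => congrFun (hcoeff S hS) v)
    x (fun _ => true)
  simpa [cubeWave, cubeCharacter] using this

theorem exists_secondLargestAdjEigenvalue_le [Nonempty V] :
    ∃ j, secondLargestAdjEigenvalue (cubeConnected G) ≤ largestLoopedEigenvalue G (oneNeg j) := by
  by_contra! hμ
  obtain ⟨u, v, hu, hv, huv, huA, hvA, hle, -⟩ :=
    exists_eigenvectors_eigenvalueDesc_one (isHermitian_adjMatrix (cubeConnected G))
  set μ := secondLargestAdjEigenvalue (cubeConnected G) with hμdef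
  set ν := eigenvalueDesc (isHermitian_adjMatrix (cubeConnected G)) 0
  change μ ≤ ν at hle
  change _ = μ • v at hvA
  obtain ⟨p, rfl⟩ := exists_eq_cubeWave_empty G (fun j => (hμ j).trans_le hle) huA
  obtain ⟨q, rfl⟩ := exists_eq_cubeWave_empty G hμ hvA
  obtain ⟨j⟩ := ‹Nonempty V›
  have : Nonempty V := ⟨j⟩
  obtain ⟨a, b, hab, h0⟩ := exists_ne_zero_combination (p j) (q j)
  have hpos : (0 : ℝ) < 2 ^ Fintype.card V := by positivity
  rw [cubeWave_dotProduct_self_character] at hu hv huv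
  have hp : 0 < p ⬝ᵥ p := pos_of_mul_pos_right (hu ▸ one_pos) hpos.le
  have hq : 0 < q ⬝ᵥ q := pos_of_mul_pos_right (hv ▸ one_pos) hpos.le
  have hpq : p ⬝ᵥ q = 0 := (mul_eq_zero.1 huv).resolve_left hpos.ne'
  have heig : ∀ {c : ℝ} {f : V → ℝ},
      (cubeConnected G).adjMatrix ℝ *ᵥ cubeWave f ∅ = c • cubeWave f ∅ →
      loopedAdjMatrix G (signVector ∅) *ᵥ f = c • f := fun {c f} h => by
    rw [adjMatrix_cubeConnected_mulVec_cubeWave] at h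
    funext v
    simpa [cubeWave, cubeCharacter] using congrFun h (v, fun _ => true)
  have hpA := heig huA
  have hqA := heig hvA
  set w := a • p + b • q with hw
  -- The blocks `∅` and `{j}` differ only in the loop at `j`, so their forms agree on `w`.
  have hwj : w j = 0 := by simpa [hw] using h0
  have hform : w ⬝ᵥ loopedAdjMatrix G (oneNeg j) *ᵥ w =
      w ⬝ᵥ loopedAdjMatrix G (signVector ∅) *ᵥ w := by
    simp only [loopedAdjMatrix_quadraticForm]
    congr 1
    refine Finset.sum_congr rfl fun i _ => ?_
    by_cases hi : i = j
    · rw [hi, hwj]; simp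
    · simp [oneNeg, signVector, hi]
  obtain ⟨-, -, -, hbound⟩ :=
    exists_eigenvector_eigenvalueDesc_zero (isHermitian_loopedAdjMatrix G (oneNeg j))
  have h := hbound w
  rw [hform, hw, quadraticForm_combination (isHermitian_loopedAdjMatrix G _)
    (by rw [hqA, dotProduct_smul, hpq, smul_zero]), dotProduct_self_combination hpq,
    hpA, hqA, dotProduct_smul, dotProduct_smul, smul_eq_mul, smul_eq_mul] at h
  have hsum := combination_pos hp hq hab
  have hlt := mul_lt_mul_of_pos_right (hμ j) hsum
  have : a ^ 2 * (μ * (p ⬝ᵥ p)) ≤ a ^ 2 * (ν * (p ⬝ᵥ p)) := by gcongr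
  unfold largestLoopedEigenvalue at hlt
  linarith

theorem isGreatest_secondLargestAdjEigenvalue [Nonempty V] :
    IsGreatest (Set.range fun j : V => largestLoopedEigenvalue G (oneNeg j))
      (secondLargestAdjEigenvalue (cubeConnected G)) := by
  obtain ⟨j, hj⟩ := exists_secondLargestAdjEigenvalue_le G
  refine ⟨⟨j, le_antisymm (largestLoopedEigenvalue_le_secondLargestAdjEigenvalue G j) hj⟩, ?_⟩
  rintro _ ⟨i, rfl⟩
  exact largestLoopedEigenvalue_le_secondLargestAdjEigenvalue G i

end SecondEigenvalue

/-! ### Algebraic connectivity of the cube-connected cycles -/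

section CubeConnectedCycles

open Matrix

theorem lapMatrix_cubeConnected_mulVec_cubeWave {V : Type*} [Fintype V] [DecidableEq V]
    (G : SimpleGraph V) [DecidableRel G.Adj] (f : V → ℝ) (S : Finset V) :
    (cubeConnected G).lapMatrix ℝ *ᵥ cubeWave f S =
      cubeWave (G.lapMatrix ℝ *ᵥ f + (1 - signVector S) * f) S := by
  funext ⟨v, x⟩
  have hdeg : ((cubeConnected G).degree (v, x) : ℝ) = G.degree v + 1 := by
    have h1 := adjMatrix_cubeConnected_mulVec G (fun _ => 1) v x
    simpa using h1
  rw [SimpleGraph.lapMatrix_mulVec_apply, ← SimpleGraph.adjMatrix_mulVec_apply,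
    adjMatrix_cubeConnected_mulVec_cubeWave, hdeg]
  simp only [cubeWave, loopedAdjMatrix_mulVec_apply, Pi.add_apply, Pi.mul_apply, Pi.sub_apply,
    Pi.one_apply]
  rw [SimpleGraph.lapMatrix_mulVec_apply, ← SimpleGraph.adjMatrix_mulVec_apply]
  ring

theorem cycleGraph_lapMatrix_mulVec_apply {n : ℕ} (f : Fin (n + 3) → ℝ) (i : Fin (n + 3)) :
    ((SimpleGraph.cycleGraph (n + 3)).lapMatrix ℝ *ᵥ f) i = 2 * f i - (f (i - 1) + f (i + 1)) := by
  rw [SimpleGraph.lapMatrix_mulVec_apply, SimpleGraph.cycleGraph_degree_three_le,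
    SimpleGraph.cycleGraph_neighborFinset, Finset.sum_pair]
  · norm_num
  -- The two neighbours are distinct because `2 ≠ 0` in `Fin (n + 3)`.
  · simp only [ne_eq, sub_eq_iff_eq_add, add_assoc i, left_eq_add]
    exact ne_of_beq_false rfl

/-- The first Dirichlet eigenfunction of the cycle with respect to the vertex `0`. -/
noncomputable def cycleSine (d : ℕ) (i : Fin d) : ℝ := Real.sin (Real.pi * i / d)

theorem cycleSine_lapMatrix {n : ℕ} {i : Fin (n + 3)} (hi : i ≠ 0) :
    ((SimpleGraph.cycleGraph (n + 3)).lapMatrix ℝ *ᵥ cycleSine (n + 3)) i =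
      2 * (1 - Real.cos (Real.pi / (n + 3 : ℕ))) * cycleSine (n + 3) i := by
  rw [cycleGraph_lapMatrix_mulVec_apply]
  set θ := Real.pi / (n + 3 : ℕ) with hθ
  have hs : ∀ k : Fin (n + 3), cycleSine (n + 3) k = Real.sin (k * θ) := fun k => by
    rw [cycleSine, hθ]; congr 1; ring
  have hpred : cycleSine (n + 3) (i - 1) = Real.sin (i * θ - θ) := by
    have : 1 ≤ i.1 := Nat.one_le_iff_ne_zero.2 fun h => hi (Fin.ext h)
    rw [hs, Fin.val_sub_one_of_ne_zero hi, Nat.cast_sub this]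
    congr 1; push_cast; ring
  have hsucc : cycleSine (n + 3) (i + 1) = Real.sin (i * θ + θ) := by
    rw [hs, Fin.val_add_one]
    split_ifs with h
    -- The successor wraps around to `0`, and `sin π = 0` matches the value there.
    · have : (i : ℕ) * θ + θ = Real.pi := by
        rw [h, Fin.val_last, hθ]; push_cast; field_simp; ring
      rw [this]; simp
    · congr 1; push_cast; ring
  rw [hpred, hsucc, hs, Real.sin_sub, Real.sin_add]
  ring

theorem algebraicConnectivity_cubeConnectedCycles_le (n : ℕ) :
    algebraicConnectivity (cubeConnectedCycles (n + 3)) ≤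
      2 * (1 - Real.cos (Real.pi / (n + 3 : ℕ))) := by
  set f := cycleSine (n + 3)
  set c := 2 * (1 - Real.cos (Real.pi / (n + 3 : ℕ))) with hc
  have hf0 : f 0 = 0 := by simp [f, cycleSine]
  have hf1 : f 1 ≠ 0 := by
    have : (0 : ℝ) < n + 3 := by positivity
    refine (Real.sin_pos_of_pos_of_lt_pi ?_ ?_).ne'
    · have := Real.pi_pos
      simp; positivity
    · have := Real.pi_pos
      push_cast
      rw [div_lt_iff₀ (by positivity)]
      simp
      nlinarith
  have hlap : f ⬝ᵥ ((SimpleGraph.cycleGraph (n + 3)).lapMatrix ℝ *ᵥ f +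
      (1 - signVector {0}) * f) = c * (f ⬝ᵥ f) := by
    simp only [dotProduct, Finset.mul_sum]
    refine Finset.sum_congr rfl fun i _ => ?_
    by_cases hi : i = 0
    -- The sine need not satisfy the eigenvalue equation at `0`, but there it is weighted by `f 0 =
    -- 0`.
    · rw [hi, hf0]; simp
    · simp only [Pi.add_apply, Pi.mul_apply, Pi.sub_apply, f, cycleSine_lapMatrix hi]
      simp only [signVector, Finset.mem_singleton, hi, if_false, Pi.one_apply]
      ring
  have hone : (cubeConnected (SimpleGraph.cycleGraph (n + 3))).lapMatrix ℝ *ᵥ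
      cubeWave (fun _ => 1) ∅ = 0 := by
    have : cubeWave (fun _ : Fin (n + 3) => (1 : ℝ)) ∅ = fun _ => 1 := by
      funext p; simp [cubeWave, cubeCharacter]
    rw [this, SimpleGraph.lapMatrix_mulVec_const_eq_zero]
  have hL := isHermitian_lapMatrix (cubeConnected (SimpleGraph.cycleGraph (n + 3)))
  have hcnn : 0 ≤ c := by linarith [Real.cos_le_one (Real.pi / (n + 3 : ℕ))]
  have hpos : (0 : ℝ) < 2 ^ Fintype.card (Fin (n + 3)) := by positivity
  have hp : 0 < cubeWave (fun _ : Fin (n + 3) => (1 : ℝ)) ∅ ⬝ᵥ cubeWave (fun _ => 1) ∅ := by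
    rw [cubeWave_dotProduct_self_character]
    refine mul_pos hpos (dotProduct_self_pos_of_ne_zero fun h => ?_)
    exact one_ne_zero (congrFun h 0)
  have hq : 0 < cubeWave f {0} ⬝ᵥ cubeWave f {0} := by
    rw [cubeWave_dotProduct_self_character]
    exact mul_pos hpos (dotProduct_self_pos_of_ne_zero fun h => hf1 (congrFun h 1))
  refine eigenvalueAsc_one_le hL hp hq (cubeWave_dotProduct_singleton _ _ _) ?_ ?_ ?_
  · rw [dotProduct_mulVec_comm_of_isHermitian hL, hone, dotProduct_zero]
  · rw [hone, dotProduct_zero]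
    exact mul_nonneg hcnn hp.le
  · rw [lapMatrix_cubeConnected_mulVec_cubeWave, cubeWave_dotProduct_self_character, hlap,
      cubeWave_dotProduct_self_character]
    exact le_of_eq (by ring)

theorem eventually_one_sub_cos_pi_div_le {ε : ℝ} (hε : 0 < ε) :
    ∀ᶠ d : ℕ in atTop, 2 * (1 - Real.cos (Real.pi / d)) ≤
      (1 + ε) * (2 * (1 - Real.cos (Real.pi / ((d : ℝ) + 2)))) := by
  have hd : Tendsto (fun d : ℕ => (d : ℝ)) atTop atTop := tendsto_natCast_atTop_atTop
  have hy : Tendsto (fun d : ℕ => Real.pi / ((d : ℝ) + 2)) atTop (nhds 0) :=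
    tendsto_const_nhds.div_atTop (tendsto_atTop_add_const_right _ _ hd)
  have hl : Tendsto (fun d : ℕ => (1 + 2 / (d : ℝ)) ^ 2) atTop (nhds 1) := by
    have := ((tendsto_const_nhds (x := (2 : ℝ))).div_atTop hd).const_add 1 |>.pow 2
    simpa using this
  -- With `y = π/(d+2)`, `Real.cos_bound` gives `2(1 - cos y) ≥ y² (1 - 5/48 y²)`, where `5/48 = 2 ·
  -- 5/96`.
  have hr : Tendsto (fun d : ℕ => (1 + ε) * (1 - 5 / 48 * (Real.pi / ((d : ℝ) + 2)) ^ 2)) atTop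
      (nhds (1 + ε)) := by
    have := (((hy.pow 2).const_mul (5 / 48)).const_sub 1).const_mul (1 + ε)
    simpa using this
  filter_upwards [hl.eventually_lt hr (by linarith), hy.eventually_le_const one_pos,
    eventually_gt_atTop 0] with d h1 h2 h3
  have hdpos : (0 : ℝ) < d := by exact_mod_cast h3
  set y := Real.pi / ((d : ℝ) + 2) with hydef
  have hypos : 0 < y := by have := Real.pi_pos; positivity
  have hx : Real.pi / d = (1 + 2 / (d : ℝ)) * y := by
    rw [hydef]; field_simp
  have hcos := Real.cos_bound (x := y) (by rwa [abs_of_pos hypos])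
  rw [abs_of_pos hypos] at hcos
  have hupper := (abs_le.1 hcos).2
  have hlower := Real.one_sub_sq_div_two_le_cos (x := Real.pi / d)
  calc 2 * (1 - Real.cos (Real.pi / d)) ≤ (Real.pi / d) ^ 2 := by linarith
    _ = (1 + 2 / (d : ℝ)) ^ 2 * y ^ 2 := by rw [hx]; ring
    _ ≤ (1 + ε) * (1 - 5 / 48 * y ^ 2) * y ^ 2 := by gcongr
    _ = (1 + ε) * (2 * (y ^ 2 / 2 - y ^ 4 * (5 / 96))) := by ring
    _ ≤ _ := mul_le_mul_of_nonneg_left (by linarith) (by linarith)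

theorem eventually_algebraicConnectivity_cubeConnectedCycles_le {ε : ℝ} (hε : 0 < ε) :
    ∀ᶠ d : ℕ in atTop, algebraicConnectivity (cubeConnectedCycles d) ≤
      (1 + ε) * (2 * (1 - Real.cos (Real.pi / ((d : ℝ) + 2)))) := by
  filter_upwards [eventually_one_sub_cos_pi_div_le hε, eventually_ge_atTop 3] with d h1 h2
  obtain ⟨n, rfl⟩ := Nat.exists_eq_add_of_le' h2
  exact (algebraicConnectivity_cubeConnectedCycles_le n).trans h1

theorem algebraicConnectivity_nonneg {V : Type*} [Fintype V] [DecidableEq V]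
    (G : SimpleGraph V) [DecidableRel G.Adj] : 0 ≤ algebraicConnectivity G :=
  eigenvalueAsc_nonneg (G.posSemidef_lapMatrix ℝ) 1

theorem algebraicConnectivity_cubeConnectedCycles_isBigO :
    (fun d : ℕ => algebraicConnectivity (cubeConnectedCycles d)) =O[atTop]
      fun d : ℕ => 2 * (1 - Real.cos (Real.pi / ((d : ℝ) + 2))) := by
  refine IsBigO.of_bound (1 + 1) ?_
  filter_upwards [eventually_algebraicConnectivity_cubeConnectedCycles_le one_pos] with d h
  rw [Real.norm_of_nonneg (algebraicConnectivity_nonneg _), Real.norm_of_nonneg]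
  · exact h
  · linarith [Real.cos_le_one (Real.pi / ((d : ℝ) + 2))]

end CubeConnectedCycles

theorem mainTheorem7 :
    (∀ {V : Type*} [Fintype V] [DecidableEq V] (G : SimpleGraph V) [DecidableRel G.Adj],
      G.Connected →
        IsGreatest (Set.range fun j : V => largestLoopedEigenvalue G (oneNeg j))
          (secondLargestAdjEigenvalue (cubeConnected G))) ∧
    ((fun d : ℕ => algebraicConnectivity (cubeConnectedCycles d)) =O[atTop]
      fun d : ℕ => 2 * (1 - Real.cos (Real.pi / ((d : ℝ) + 2)))) ∧
    (∀ ε : ℝ, 0 < ε → ∀ᶠ d : ℕ in atTop,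
      algebraicConnectivity (cubeConnectedCycles d) ≤
        (1 + ε) * (2 * (1 - Real.cos (Real.pi / ((d : ℝ) + 2))))) := by
  exact ⟨fun G _ hG => have := hG.nonempty; isGreatest_secondLargestAdjEigenvalue G,
    algebraicConnectivity_cubeConnectedCycles_isBigO,
    fun _ => eventually_algebraicConnectivity_cubeConnectedCycles_le⟩
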